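/- **Theorem.** Let $k,m,n\ge 1$ be integers. Let $G=G(k,m,n)$ be the spatial graph obtained as follows. Take two parallel strands (an upper and a lower one) running around an annulus in the plane and twist them around each other in one block of $k$ right-handed half-twists; then join the two strands, outside the block, by two vertical struts $c$ and $d$ (so $G$ has four trivalent vertices, the ends of the struts, and no crossings other than the $k$ crossings of the block). Its six edges are: the two edges $a$ and $b$ that pass through the block, where on the right-hand side of the block $a$ is the lower and $b$ the upper strand, both ending at the strut $d$; the struts $c$ and $d$; and the two edges $e$ (lower strand) and $f$ (upper strand) that run between the struts on the side away from the block. Orient the edges of $G$ in any way, and give $(a,b,c,d,e,f)$ the labels $N=(2,2,m,n,2,2)$. Let $Q_N(G)$ be the fundamental $N$-quandle of $G$: the quandle with one generator for every arc of the diagram and the following relations, where $x\rhd^{-1}y$ denotes the inverse operation of $x\rhd y$. At each crossing, $l=r\rhd o$, where $o$ is the over-arc and $l$, $r$ are the under-arcs on its left and right. At each vertex, $((x\rhd^{\varepsilon_1}a_1)\rhd^{\varepsilon_2}a_2)\rhd^{\varepsilon_3}a_3=x$ for all $x$, where $a_1,a_2,a_3$ are the arcs at the vertex in clockwise order and $\varepsilon_i=1$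 or $-1$ according to whether $a_i$ is directed into or out of the vertex. For each arc $y$, $(\cdots((x\rhd y)\rhd y)\cdots)\rhd y=x$ for all $x$, with as many factors $y$ as the label of the edge containing $y$. Then $$|Q_N(G)|=4kmn+2km+2kn .$$ Moreover, $Q_N(G)$ has exactly six components (orbits of its inner automorphism group), one for each edge $u\in\{a,b,c,d,e,f\}$, namely the component $Q_u$ containing all generators given by arcs of $u$, and $$|Q_a|=|Q_b|=|Q_e|=|Q_f|=kmn,\qquad |Q_d|=2km,\qquad |Q_c|=2kn .$$ -/

import Mathlib

open scoped Quandles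

/-! ### Presented quandles

Mathlib's `y ◃ x` is the quandle product usually written `x ▷ y` or `x ^ y`, and
`y ◃⁻¹ x` is `x ▷⁻¹ y`. -/

/-- Formal quandle expressions in generators from `S`: `act y x` stands for `x ▷ y` and
`invAct y x` for `x ▷⁻¹ y`. -/
inductive QuandleTerm (S : Type) : Type
  | of (s : S) : QuandleTerm S
  | act (y x : QuandleTerm S) : QuandleTerm S
  | invAct (y x : QuandleTerm S) : QuandleTerm S

/-- The smallest congruence on quandle expressions that contains the relations `R` and makes the
quandle axioms hold. -/
inductive QuandleTerm.Equiv {S : Type} (R : QuandleTerm S → QuandleTerm S → Prop) :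
    QuandleTerm S → QuandleTerm S → Prop
  | base {x y} : R x y → Equiv R x y
  | refl (x) : Equiv R x x
  | symm {x y} : Equiv R x y → Equiv R y x
  | trans {x y z} : Equiv R x y → Equiv R y z → Equiv R x z
  | act_congr {y y' x x'} : Equiv R y y' → Equiv R x x' → Equiv R (.act y x) (.act y' x')
  | invAct_congr {y y' x x'} :
      Equiv R y y' → Equiv R x x' → Equiv R (.invAct y x) (.invAct y' x')
  | self_distrib (x y z) : Equiv R (.act x (.act y z)) (.act (.act x y) (.act x z))
  | left_inv (y x) : Equiv R (.invAct y (.act y x)) x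
  | right_inv (y x) : Equiv R (.act y (.invAct y x)) x
  | fix (x) : Equiv R (.act x x) x

/-- The setoid of `QuandleTerm.Equiv`. -/
def QuandleTerm.setoid {S : Type} (R : QuandleTerm S → QuandleTerm S → Prop) :
    Setoid (QuandleTerm S) where
  r := QuandleTerm.Equiv R
  iseqv := ⟨.refl, .symm, .trans⟩

/-- The quandle `⟨S | R⟩`. -/
def PresentedQuandle {S : Type} (R : QuandleTerm S → QuandleTerm S → Prop) : Type :=
  Quotient (QuandleTerm.setoid R)

namespace PresentedQuandle

variable {S : Type} (R : QuandleTerm S → QuandleTerm S → Prop)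

instance : Quandle (PresentedQuandle R) where
  act := Quotient.map₂ QuandleTerm.act fun _ _ h _ _ h' => .act_congr h h'
  invAct := Quotient.map₂ QuandleTerm.invAct fun _ _ h _ _ h' => .invAct_congr h h'
  self_distrib := by
    rintro ⟨x⟩ ⟨y⟩ ⟨z⟩
    exact Quotient.sound (.self_distrib x y z)
  left_inv := by
    rintro ⟨y⟩ ⟨x⟩
    exact Quotient.sound (.left_inv y x)
  right_inv := by
    rintro ⟨y⟩ ⟨x⟩
    exact Quotient.sound (.right_inv y x)
  fix := by
    rintro ⟨x⟩
    exact Quotient.sound (.fix x)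

/-- The element of `⟨S | R⟩` given by a generator. -/
def gen (s : S) : PresentedQuandle R := Quotient.mk (QuandleTerm.setoid R) (.of s)

end PresentedQuandle

/-- The inner automorphism group: the group of bijections of `Q` generated by the point
symmetries `x ↦ x ▷ y`. -/
def quandleInn (Q : Type) [Quandle Q] : Subgroup (Equiv.Perm Q) :=
  Subgroup.closure (Set.range fun y : Q => (Rack.act' y : Equiv.Perm Q))

/-- The algebraic component of `x`: its orbit under the inner automorphism group. -/
def quandleComponent {Q : Type} [Quandle Q] (x : Q) : Set Q :=
  MulAction.orbit (quandleInn Q) x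

/-! ### Diagrams of oriented spatial graphs and their quandles -/

/-- A diagram of an oriented spatial graph, recorded by its arcs and by what is seen at each
crossing and at each vertex. At a crossing, `leftArc` and `rightArc` are the two under-arcs on the left
and on the right of the oriented over-arc. At a vertex, `incident v` lists the ends of arcs at `v`
in clockwise order (from an arbitrary starting point), each with `true` if the arc is directed into
the vertex and `false` if it is directed out of the vertex. -/
structure SpatialGraphDiagram where
  /-- edges of the graph -/
  Edge : Type
  /-- arcs of the diagram -/
  Arc : Type
  /-- the edge that an arc is part of -/
  edge : Arc → Edge
  /-- crossings of the diagram -/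
  Crossing : Type
  /-- the over-arc -/
  overArc : Crossing → Arc
  /-- the under-arc on the left of the over-arc -/
  leftArc : Crossing → Arc
  /-- the under-arc on the right of the over-arc -/
  rightArc : Crossing → Arc
  /-- the under-arcs at a crossing are parts of one edge -/
  edge_left : ∀ x, edge (leftArc x) = edge (rightArc x)
  /-- vertices of the graph -/
  Vertex : Type
  /-- the arc ends around a vertex in clockwise order, with `true` for incoming ones -/
  incident : Vertex → List (Arc × Bool)

namespace SpatialGraphDiagram

/-- The same diagram with the orientation of every edge `e` with `s e = true` reversed. -/
def reorient (D : SpatialGraphDiagram) (s : D.Edge → Bool) : SpatialGraphDiagram where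
  Edge := D.Edge
  Arc := D.Arc
  edge := D.edge
  Crossing := D.Crossing
  overArc := D.overArc
  leftArc x := if s (D.edge (D.overArc x)) then D.rightArc x else D.leftArc x
  rightArc x := if s (D.edge (D.overArc x)) then D.leftArc x else D.rightArc x
  edge_left x := by
    split
    · exact (D.edge_left x).symm
    · exact D.edge_left x
  Vertex := D.Vertex
  incident v := (D.incident v).map fun p => (p.1, p.2 ^^ s (D.edge p.1))

variable (D : SpatialGraphDiagram)

/-- `((x ▷^ε₁ a₁) ▷^ε₂ a₂) ⋯ ▷^εᵣ aᵣ` for a list of arcs `aᵢ`, with `εᵢ = 1` for `true` and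
`εᵢ = -1` for `false`. -/
def wordAct (x : QuandleTerm D.Arc) (w : List (D.Arc × Bool)) : QuandleTerm D.Arc :=
  w.foldl (fun z p => if p.2 then .act (.of p.1) z else .invAct (.of p.1) z) x

/-- The Wirtinger relations: `l = r ▷ o` at a crossing with over-arc `o` and under-arcs `l` on its
left and `r` on its right, and `((x ▷^ε₁ a₁) ▷^ε₂ a₂) ⋯ ▷^εᵣ aᵣ = x` for all `x` at a vertex. -/
inductive WirtingerRel : QuandleTerm D.Arc → QuandleTerm D.Arc → Prop
  | crossing (c : D.Crossing) :
      WirtingerRel (.of (D.leftArc c)) (.act (.of (D.overArc c)) (.of (D.rightArc c)))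
  | vertex (v : D.Vertex) (x : QuandleTerm D.Arc) : WirtingerRel (D.wordAct x (D.incident v)) x

/-- The fundamental quandle, in the Wirtinger presentation of the diagram. -/
abbrev FundamentalQuandle : Type := PresentedQuandle D.WirtingerRel

/-- The relations of the fundamental `N`-quandle: the Wirtinger relations, and
`(⋯((x ▷ y) ▷ y)⋯) ▷ y = x` (`N e` factors `y`) for every arc `y` of an edge `e`. -/
inductive NRel (N : D.Edge → ℕ) : QuandleTerm D.Arc → QuandleTerm D.Arc → Prop
  | wirtinger {x y} : D.WirtingerRel x y → NRel N x y
  | power (y : D.Arc) (x : QuandleTerm D.Arc) :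
      NRel N ((QuandleTerm.act (.of y))^[N (D.edge y)] x) x

/-- The fundamental `N`-quandle. -/
abbrev NQuandle (N : D.Edge → ℕ) : Type := PresentedQuandle (D.NRel N)

/-- The element of the fundamental `N`-quandle given by an arc. -/
abbrev arcGen (N : D.Edge → ℕ) (x : D.Arc) : D.NQuandle N := PresentedQuandle.gen (D.NRel N) x

end SpatialGraphDiagram

/-! ### The twisted band with two struts

Draw two parallel strands, an upper and a lower one, running around an annulus; cut it open and
read from left to right. First comes a block of `k` right-handed half-twists of the two strands.
On its right the lower strand is `a` and the upper strand is `b`. They run to the vertices `v₁`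
(lower) and `v₂` (upper), which are joined by the vertical strut `d`. From there the lower strand
`e` and the upper strand `f` run to the vertices `v₃` (lower) and `v₄` (upper), which are joined by
the vertical strut `c`. From there the strands return, without crossing, to the left side of the
block.

The arcs that meet the block are numbered `0, …, k + 1`: on the right side of the block, the upper
arc is `0` and the lower arc is `1`. The half-twists, from right to left, are numbered by
`j = 0, …, k - 1`; the upper and lower arcs on the right side of half-twist `j` are `j` and `j + 1`,
those on its left side are `j + 1` and `j + 2`. So `j + 1` is the over-arc, running between the
lower right and the upper left, and the under-arcs are `j` at the upper right and `j + 2` at the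
lower left. On the left side of the block, the upper arc is `k` and the lower arc is `k + 1`.
The arcs with an even number make up the edge `b`, and those with an odd number the edge `a`. -/

/-- The six edges. -/
inductive TwistEdge : Type
  | a | b | c | d | e | f

/-- The arcs of the diagram. -/
inductive TwistArc (k : ℕ) : Type
  /-- the arcs of the edges `a` and `b` -/
  | s (i : Fin (k + 2)) : TwistArc k
  | c : TwistArc k
  | d : TwistArc k
  | e : TwistArc k
  | f : TwistArc k

/-- The four vertices. -/
inductive TwistVertex : Type
  | v₁ | v₂ | v₃ | v₄

/-- The edge that an arc is part of. -/
def TwistArc.edge {k : ℕ} : TwistArc k → TwistEdge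
  | .s i => if i.val % 2 = 0 then .b else .a
  | .c => .c
  | .d => .d
  | .e => .e
  | .f => .f

/-- The diagram of the graph, with this orientation: inside the block `a` is directed to the left
and `b` to the right, `e` goes from `v₃` to `v₁`, `f` from `v₂` to `v₄`, `d` from `v₂` to `v₁`, and
`c` from `v₄` to `v₃`. -/
def twistDiagram (k : ℕ) : SpatialGraphDiagram where
  Edge := TwistEdge
  Arc := TwistArc k
  edge := TwistArc.edge
  Crossing := Fin k
  overArc j := .s ⟨j + 1, by omega⟩
  leftArc j := if (j + 1 : ℕ) % 2 = 0 then .s ⟨j, by omega⟩ else .s ⟨j + 2, by omega⟩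
  rightArc j := if (j + 1 : ℕ) % 2 = 0 then .s ⟨j + 2, by omega⟩ else .s ⟨j, by omega⟩
  edge_left j := by by_cases h : (j + 1 : ℕ) % 2 = 0 <;> simp [h, TwistArc.edge]
  Vertex := TwistVertex
  incident
    | .v₁ => [(.d, true), (.e, true), (.s ⟨1, by omega⟩, false)]
    | .v₂ => [(.s ⟨0, by omega⟩, true), (.f, false), (.d, false)]
    | .v₃ => [(.c, true), (.s ⟨k + 1, by omega⟩, decide ((k + 1) % 2 = 1)), (.e, false)]
    | .v₄ => [(.f, true), (.s ⟨k, by omega⟩, decide (k % 2 = 1)), (.c, false)]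

/-- The edge labelling `(2, 2, m, n, 2, 2)` of `(a, b, c, d, e, f)`. -/
def twistLabel (m n : ℕ) : TwistEdge → ℕ
  | .a => 2
  | .b => 2
  | .c => m
  | .d => n
  | .e => 2
  | .f => 2

/-- The number of elements in the component of each edge. -/
def twistComponentCard (k m n : ℕ) : TwistEdge → ℕ
  | .a => k * m * n
  | .b => k * m * n
  | .c => 2 * k * n
  | .d => 2 * k * m
  | .e => k * m * n
  | .f => k * m * n

/-! Everything reduces to one finite group `G` acting on the quandle `Q`. Take the symmetries of `Q`
at its generators, inverted on reversed edges. In every orientation they satisfy the Wirtinger and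
power relations of the fixed diagram, so the group `G` presented by these relations acts on `Q`,
with image the inner automorphism group, and the components are the `G`-orbits of the generators.

To compute `G`, write `A`, `B`, `D` for the elements of the arcs `s 1`, `s 0`, `d`, and `T = A * B`.
The vertex relations give `e = A * D⁻¹` and `f = B * D⁻¹`. Since `A`, `B`, `e`, `f` are involutions,
`B` inverts `T` and `D`, and `T` commutes with `D`. The crossings give `s j = T ^ j * B`, hence `c =
T ^ k * D⁻¹`. What remains is `D ^ n = 1` and `(T ^ k * D⁻¹) ^ m = 1`, so `G` is the generalized
dihedral group of `ℤ²` modulo the span of `(0, n)` and `(k * m, -m)`, of order `2kmn`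
(`TwistRelations.exists_hom`, `natCard_twistTrans`).

The stabilizer of the base generator of an edge `u` contains its meridian `y u`, because `x ▷ x =
x`. It is no larger: the disjoint union of the coset spaces `G ⧸ ⟨y u⟩` is a quandle coloured by the
arcs, and the resulting map from `Q` is `G`-equivariant and sends that generator to the trivial
coset. So the component of `u` has `2kmn / N u` elements (`IsMeridianSystem.card_component`), as `y
u` has order `N u`. The index of the coset space separates the six components, and their sizes add
up to the total. -/

/-! ### Universal property of presented quandles -/

/-- The value of a quandle expression under an assignment of the generators. -/
def QuandleTerm.eval {S M : Type} [Quandle M] (v : S → M) : QuandleTerm S → M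
  | .of s => v s
  | .act y x => y.eval v ◃ x.eval v
  | .invAct y x => y.eval v ◃⁻¹ x.eval v

theorem QuandleTerm.Equiv.eval_eq {S M : Type} [Quandle M] {v : S → M}
    {R : QuandleTerm S → QuandleTerm S → Prop} (hR : ∀ x y, R x y → x.eval v = y.eval v)
    {x y : QuandleTerm S} (h : QuandleTerm.Equiv R x y) : x.eval v = y.eval v := by
  induction h with
  | base h => exact hR _ _ h
  | refl => rfl
  | symm _ ih => exact ih.symm
  | trans _ _ ih₁ ih₂ => exact ih₁.trans ih₂
  | act_congr _ _ ih₁ ih₂ => simp only [eval, ih₁, ih₂]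
  | invAct_congr _ _ ih₁ ih₂ => simp only [eval, ih₁, ih₂]
  | self_distrib x y z => exact Shelf.self_distrib
  | left_inv y x => exact Rack.left_inv _ _
  | right_inv y x => exact Rack.right_inv _ _
  | fix x => exact Quandle.fix

namespace PresentedQuandle

variable {S : Type} {R : QuandleTerm S → QuandleTerm S → Prop}

/-- The map out of `⟨S | R⟩` given by an assignment of the generators that satisfies `R`. -/
def lift {M : Type} [Quandle M] (v : S → M) (hR : ∀ x y, R x y → x.eval v = y.eval v) :
    PresentedQuandle R → M :=
  Quotient.lift (QuandleTerm.eval v) fun _ _ h => QuandleTerm.Equiv.eval_eq hR h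

section
variable {M : Type} [Quandle M] (v : S → M) (hR : ∀ x y, R x y → x.eval v = y.eval v)

@[simp] theorem lift_act (x y : PresentedQuandle R) :
    lift v hR (x ◃ y) = lift v hR x ◃ lift v hR y := by
  obtain ⟨x⟩ := x
  obtain ⟨y⟩ := y
  rfl

@[simp] theorem lift_invAct (x y : PresentedQuandle R) :
    lift v hR (x ◃⁻¹ y) = lift v hR x ◃⁻¹ lift v hR y := by
  obtain ⟨x⟩ := x
  obtain ⟨y⟩ := y
  rfl

end

theorem mk_eq_eval (x : QuandleTerm S) :
    (Quotient.mk (QuandleTerm.setoid R) x : PresentedQuandle R) = x.eval (gen R) := by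
  induction x with
  | of s => rfl
  | act y x ihy ihx =>
    simp only [QuandleTerm.eval, ← ihy, ← ihx]
    rfl
  | invAct y x ihy ihx =>
    simp only [QuandleTerm.eval, ← ihy, ← ihx]
    rfl

theorem eval_gen_eq {x y : QuandleTerm S} (h : R x y) : x.eval (gen R) = y.eval (gen R) := by
  rw [← mk_eq_eval, ← mk_eq_eval]
  exact Quotient.sound (.base h)

theorem eval_gen_surjective (q : PresentedQuandle R) : ∃ x : QuandleTerm S, x.eval (gen R) = q := by
  obtain ⟨x⟩ := q
  exact ⟨x, (mk_eq_eval x).symm⟩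

theorem induction_on {P : PresentedQuandle R → Prop} (q : PresentedQuandle R)
    (hgen : ∀ s, P (gen R s)) (hact : ∀ x y, P x → P y → P (x ◃ y))
    (hinv : ∀ x y, P x → P y → P (x ◃⁻¹ y)) : P q := by
  obtain ⟨t, rfl⟩ := eval_gen_surjective q
  induction t with
  | of s => exact hgen s
  | act y x ihy ihx => exact hact _ _ ihy ihx
  | invAct y x ihy ihx => exact hinv _ _ ihy ihx

/-- The symmetry at `x ◃ y` is the conjugate of the symmetry at `y` by the one at `x`, so the
generators suffice. -/
theorem act'_mem_closure (q : PresentedQuandle R) :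
    Rack.act' q ∈ Subgroup.closure (Set.range fun s : S => (Rack.act' (gen R s) : Equiv.Perm _)) := by
  induction q using induction_on with
  | hgen s => exact Subgroup.subset_closure ⟨s, rfl⟩
  | hact x y hx hy =>
    rw [Rack.ad_conj]
    exact mul_mem (mul_mem hx hy) (inv_mem hx)
  | hinv x y hx hy =>
    have h : Rack.act' (x ◃⁻¹ y) = (Rack.act' x)⁻¹ * Rack.act' y * Rack.act' x := by
      have := Rack.ad_conj x (x ◃⁻¹ y)
      rw [Rack.right_inv] at this
      rw [this]
      group
    rw [h]
    exact mul_mem (mul_mem (inv_mem hx) hy) hx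

theorem quandleInn_eq_closure : quandleInn (PresentedQuandle R) =
    Subgroup.closure (Set.range fun s : S => (Rack.act' (gen R s) : Equiv.Perm _)) := by
  apply le_antisymm
  · rw [quandleInn, Subgroup.closure_le]
    rintro _ ⟨q, rfl⟩
    exact act'_mem_closure q
  · apply Subgroup.closure_mono
    rintro _ ⟨s, rfl⟩
    exact ⟨gen R s, rfl⟩

theorem exists_mem_component_gen (q : PresentedQuandle R) :
    ∃ s, q ∈ quandleComponent (gen R s) := by
  induction q using induction_on with
  | hgen s => exact ⟨s, MulAction.mem_orbit_self _⟩
  | hact x y _ hy =>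
    obtain ⟨s, hs⟩ := hy
    refine ⟨s, ?_⟩
    exact MulAction.mem_orbit_of_mem_orbit
      (⟨Rack.act' x, Subgroup.subset_closure ⟨x, rfl⟩⟩ : quandleInn (PresentedQuandle R)) hs
  | hinv x y _ hy =>
    obtain ⟨s, hs⟩ := hy
    refine ⟨s, ?_⟩
    exact MulAction.mem_orbit_of_mem_orbit
      (⟨Rack.act' x, Subgroup.subset_closure ⟨x, rfl⟩⟩ : quandleInn (PresentedQuandle R))⁻¹ hs

end PresentedQuandle

/-! ### Colourings of reoriented diagrams -/

namespace SpatialGraphDiagram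

variable (D : SpatialGraphDiagram) (s : D.Edge → Bool) (N : D.Edge → ℕ)

/-- The symmetry at the colour of an arc, inverted if `s` reverses the arc. -/
def signedAct {M : Type} [Quandle M] (v : D.Arc → M) (x : D.Arc) : Equiv.Perm M :=
  if s (D.edge x) then (Rack.act' (v x))⁻¹ else Rack.act' (v x)

/-- The word in a group that a vertex spells, in the order of composition of left actions. -/
def vertexWord {G : Type} [Group G] (m : D.Arc → G) (w : D.Vertex) : G :=
  ((D.incident w).map fun p => if p.2 then m p.1 else (m p.1)⁻¹).reverse.prod

theorem map_vertexWord {G H : Type} [Group G] [Group H] (f : G →* H) (m : D.Arc → G)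
    (w : D.Vertex) : f (D.vertexWord m w) = D.vertexWord (fun x => f (m x)) w := by
  simp only [vertexWord, map_list_prod, List.map_reverse, List.map_map]
  congr 3
  funext p
  simp only [Function.comp]
  split <;> simp

/-- Colourings of the arcs by a quandle that satisfy the relations of the fundamental `N`-quandle of
the diagram reoriented along `s`. -/
structure IsColoring {M : Type} [Quandle M] (v : D.Arc → M) : Prop where
  crossing (c : D.Crossing) : v (D.leftArc c) = D.signedAct s v (D.overArc c) (v (D.rightArc c))
  vertex (w : D.Vertex) : D.vertexWord (D.signedAct s v) w = 1
  power (x : D.Arc) : D.signedAct s v x ^ N (D.edge x) = 1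

/-- The relations of the fundamental `N`-quandle of the diagram reoriented along `s`. -/
def reorientedNRel : QuandleTerm D.Arc → QuandleTerm D.Arc → Prop := (D.reorient s).NRel N

/-- The fundamental `N`-quandle of the diagram reoriented along `s`. -/
abbrev ReorientedNQuandle : Type := PresentedQuandle (D.reorientedNRel s N)

/-- The element of `D.ReorientedNQuandle s N` given by an arc. -/
abbrev reorientedGen (x : D.Arc) : D.ReorientedNQuandle s N :=
  PresentedQuandle.gen (D.reorientedNRel s N) x

variable {D s N}

/-- Reorienting flips the exponent of a letter and inverts its `signedAct`; the two changes cancel.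
The list is reversed because `foldl` applies its first letter first, while a product of permutations
applies its last factor first. -/
theorem eval_wordAct_reorient {M : Type} [Quandle M] (v : D.Arc → M) (l : List (D.Arc × Bool))
    (x : QuandleTerm D.Arc) :
    ((D.reorient s).wordAct x (l.map fun p => (p.1, p.2 ^^ s (D.edge p.1)))).eval v =
      (l.map fun p => if p.2 then D.signedAct s v p.1 else (D.signedAct s v p.1)⁻¹).reverse.prod
        (x.eval v) := by
  induction l generalizing x with
  | nil => rfl
  | cons p l ih =>
    rw [List.map_cons, List.map_cons, List.reverse_cons, List.prod_append, Equiv.Perm.mul_apply]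
    refine (ih _).trans (congrArg _ ?_)
    obtain ⟨a, b⟩ := p
    cases b <;> cases h : s (D.edge a) <;>
      simp only [signedAct, h, List.prod_singleton, Bool.xor_false, Bool.xor_true, Bool.not_true,
        Bool.not_false, if_true, Bool.false_eq_true, if_false, inv_inv] <;> rfl

theorem eval_iterate_act {M : Type} [Quandle M] (v : D.Arc → M) (y : D.Arc) (i : ℕ)
    (x : QuandleTerm D.Arc) :
    ((QuandleTerm.act (.of y))^[i] x).eval v = (Rack.act' (v y) ^ i : Equiv.Perm M) (x.eval v) := by
  induction i generalizing x with
  | zero => rfl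
  | succ i ih =>
    rw [Function.iterate_succ_apply, ih, pow_succ, Equiv.Perm.mul_apply]
    rfl

theorem signedAct_pow_eq_one_iff {M : Type} [Quandle M] (v : D.Arc → M) (x : D.Arc) (i : ℕ) :
    D.signedAct s v x ^ i = 1 ↔ (Rack.act' (v x) ^ i : Equiv.Perm M) = 1 := by
  unfold signedAct
  split
  · rw [inv_pow, inv_eq_one]
  · rfl

theorem NRel.eval_eq {E : SpatialGraphDiagram} {N : E.Edge → ℕ} {M : Type} [Quandle M]
    {v : E.Arc → M} (hc : ∀ c, v (E.leftArc c) = v (E.overArc c) ◃ v (E.rightArc c))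
    (hv : ∀ w x, (E.wordAct x (E.incident w)).eval v = x.eval v)
    (hp : ∀ a x, ((QuandleTerm.act (.of a))^[N (E.edge a)] x).eval v = x.eval v)
    {x y : QuandleTerm E.Arc} (h : E.NRel N x y) : x.eval v = y.eval v := by
  cases h with
  | wirtinger h =>
    cases h with
    | crossing c => exact hc c
    | vertex w x => exact hv w y
  | power a x => exact hp a y

theorem IsColoring.eval_eq {M : Type} [Quandle M] {v : D.Arc → M} (h : D.IsColoring s N v)
    (x y : QuandleTerm D.Arc) (hxy : D.reorientedNRel s N x y) : x.eval v = y.eval v := by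
  refine NRel.eval_eq (E := D.reorient s) (v := v) (fun c => ?_) (fun w x => ?_) (fun a x => ?_) hxy
  · have hc := h.crossing c
    change v ((D.reorient s).leftArc c) = v (D.overArc c) ◃ v ((D.reorient s).rightArc c)
    simp only [reorient]
    cases hs : s (D.edge (D.overArc c))
    · simpa [signedAct, hs] using hc
    · simp only [signedAct, hs, if_true] at hc ⊢
      rw [hc]
      exact (Rack.right_inv (v (D.overArc c)) (v (D.rightArc c))).symm
  · exact (eval_wordAct_reorient v (D.incident w) _).trans (DFunLike.congr_fun (h.vertex w) _)
  · refine (eval_iterate_act (D := D) v a _ _).trans ?_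
    exact DFunLike.congr_fun ((signedAct_pow_eq_one_iff v a _).1 (h.power a)) _

theorem isColoring_reorientedGen : D.IsColoring s N (D.reorientedGen s N) where
  crossing c := by
    have h : QuandleTerm.eval (D.reorientedGen s N) (.of ((D.reorient s).leftArc c)) =
        QuandleTerm.eval (D.reorientedGen s N)
          (.act (.of (D.overArc c)) (.of ((D.reorient s).rightArc c))) :=
      PresentedQuandle.eval_gen_eq
        (NRel.wirtinger (D := D.reorient s) (WirtingerRel.crossing (D := D.reorient s) c))
    simp only [signedAct]
    cases hs : s (D.edge (D.overArc c))
    · simp only [reorient, hs, Bool.false_eq_true, if_false] at h ⊢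
      exact h
    -- Reversing the over-arc exchanges left and right, so the relation reads `r = l ▷ o`, that is
    -- `l = r ▷⁻¹ o`.
    · have h₁ : (D.reorient s).leftArc c = D.rightArc c := by simp [reorient, hs]
      have h₂ : (D.reorient s).rightArc c = D.leftArc c := by simp [reorient, hs]
      rw [h₁, h₂] at h
      simp only [if_true]
      change D.reorientedGen s N (D.rightArc c) =
        D.reorientedGen s N (D.overArc c) ◃ D.reorientedGen s N (D.leftArc c) at h
      rw [h]
      exact (Rack.left_inv (D.reorientedGen s N (D.overArc c)) (D.reorientedGen s N (D.leftArc c))).symm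
  vertex w := by
    ext q
    obtain ⟨x, rfl⟩ := PresentedQuandle.eval_gen_surjective q
    have h := PresentedQuandle.eval_gen_eq (R := D.reorientedNRel s N)
      (NRel.wirtinger (D := D.reorient s) (WirtingerRel.vertex (D := D.reorient s) w x))
    exact (eval_wordAct_reorient _ (D.incident w) x).symm.trans h
  power a := by
    rw [signedAct_pow_eq_one_iff]
    ext q
    obtain ⟨x, rfl⟩ := PresentedQuandle.eval_gen_surjective q
    have h := PresentedQuandle.eval_gen_eq (R := D.reorientedNRel s N)
      (NRel.power (D := D.reorient s) a x)
    exact (eval_iterate_act _ a _ x).symm.trans h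

end SpatialGraphDiagram

/-! ### Coset quandles -/

/-- The union of the left coset spaces of the cyclic subgroups generated by the `y i`. -/
def CosetQuandle {ι G : Type} [Group G] (y : ι → G) : Type :=
  Σ i, G ⧸ Subgroup.zpowers (y i)

namespace CosetQuandle

variable {ι G : Type} [Group G] {y : ι → G}

/-- The coset of `g` in the part with index `i`. -/
def mk (y : ι → G) (i : ι) (g : G) : CosetQuandle y := ⟨i, (g : G ⧸ Subgroup.zpowers (y i))⟩

instance : MulAction G (CosetQuandle y) :=
  inferInstanceAs (MulAction G (Σ i, G ⧸ Subgroup.zpowers (y i)))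

theorem exists_mk (x : CosetQuandle y) : ∃ i g, mk y i g = x := by
  obtain ⟨i, q⟩ := x
  obtain ⟨g, rfl⟩ := QuotientGroup.mk_surjective q
  exact ⟨i, g, rfl⟩

@[simp] theorem smul_mk (g h : G) (i : ι) : g • mk y i h = mk y i (g * h) := rfl

theorem mk_eq_mk {i : ι} {g h : G} : mk y i g = mk y i h ↔ g⁻¹ * h ∈ Subgroup.zpowers (y i) := by
  rw [← QuotientGroup.eq]
  exact ⟨fun h => eq_of_heq (Sigma.mk.inj h).2, fun h => congrArg (Sigma.mk i) h⟩

/-- The augmentation, which sends the coset of `g` in the part with index `i` to the conjugate of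
`y i` by `g`. -/
def aug (x : CosetQuandle y) : G :=
  Quotient.liftOn' x.2 (fun g => g * y x.1 * g⁻¹) fun g h hgh => by
    rw [QuotientGroup.leftRel_apply] at hgh
    obtain ⟨j, hj⟩ := Subgroup.mem_zpowers_iff.1 hgh
    obtain rfl : h = g * y x.1 ^ j := by rw [hj]; group
    group

@[simp] theorem aug_mk (i : ι) (g : G) : aug (mk y i g) = g * y i * g⁻¹ := rfl

theorem aug_smul (g : G) (x : CosetQuandle y) : aug (g • x) = g * aug x * g⁻¹ := by
  obtain ⟨i, h, rfl⟩ := exists_mk x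
  simp only [smul_mk, aug_mk]
  group

theorem aug_smul_self (x : CosetQuandle y) : aug x • x = x := by
  obtain ⟨i, h, rfl⟩ := exists_mk x
  rw [aug_mk, smul_mk, mk_eq_mk]
  convert inv_mem (Subgroup.mem_zpowers (y i)) using 1
  group

/-- This is an augmented quandle: equivariance of `aug` gives self-distributivity, and `aug x`
fixing `x` gives idempotence. -/
instance : Quandle (CosetQuandle y) where
  act x z := aug x • z
  invAct x z := (aug x)⁻¹ • z
  self_distrib {x z w} := by
    rw [aug_smul, smul_smul, smul_smul]
    group
  left_inv x z := inv_smul_smul _ _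
  right_inv x z := smul_inv_smul _ _
  fix {x} := aug_smul_self x

theorem act'_eq (x : CosetQuandle y) : Rack.act' x = MulAction.toPermHom G _ (aug x) := rfl

theorem mem_zpowers_of_smul_mk {g : G} {i : ι} (h : g • mk y i 1 = mk y i 1) :
    g ∈ Subgroup.zpowers (y i) := by
  rw [smul_mk, mk_eq_mk] at h
  simpa using h

end CosetQuandle

/-! ### `N`-quandles from a group acting on them -/

namespace SpatialGraphDiagram

variable {D : SpatialGraphDiagram} {s : D.Edge → Bool} {N : D.Edge → ℕ}
  {G : Type} [Group G] (y : D.Edge → G) (γ m : D.Arc → G)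

/-- Assignments of group elements `m` to the arcs that satisfy the Wirtinger relations and the
power relations. Here `γ` records how the arc is obtained from the base point of its edge. -/
structure IsMeridianSystem (D : SpatialGraphDiagram) (N : D.Edge → ℕ) (y : D.Edge → G)
    (γ m : D.Arc → G) : Prop where
  conj (x : D.Arc) : m x = γ x * y (D.edge x) * (γ x)⁻¹
  crossing (c : D.Crossing) : (γ (D.leftArc c))⁻¹ * (m (D.overArc c) * γ (D.rightArc c)) ∈
    Subgroup.zpowers (y (D.edge (D.leftArc c)))
  vertex (w : D.Vertex) : D.vertexWord m w = 1
  power (x : D.Arc) : m x ^ N (D.edge x) = 1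

/-- The elements `y`, inverted on the edges that `s` reverses. -/
def signed (s : D.Edge → Bool) (y : D.Edge → G) (u : D.Edge) : G := if s u then (y u)⁻¹ else y u

/-- Hence the coset spaces do not depend on the orientation; only the augmentation does. -/
theorem zpowers_signed (u : D.Edge) :
    Subgroup.zpowers (signed s y u) = Subgroup.zpowers (y u) := by
  unfold signed
  split
  · exact Subgroup.zpowers_inv (g := y u)
  · rfl

/-- The colouring of the arcs by the coset quandle. -/
def cosetColoring (s : D.Edge → Bool) (x : D.Arc) : CosetQuandle (signed s y) :=
  .mk _ (D.edge x) (γ x)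

variable {y γ m}

theorem IsMeridianSystem.signedAct_cosetColoring (h : D.IsMeridianSystem N y γ m) (x : D.Arc) :
    D.signedAct s (cosetColoring y γ s) x = MulAction.toPermHom G _ (m x) := by
  unfold signedAct
  rw [CosetQuandle.act'_eq, cosetColoring, CosetQuandle.aug_mk, h.conj x]
  unfold signed
  split
  · rw [← map_inv]
    congr 1
    group
  · rfl

theorem IsMeridianSystem.isColoring (h : D.IsMeridianSystem N y γ m) :
    D.IsColoring s N (cosetColoring y γ s) := by
  have key : D.signedAct s (cosetColoring y γ s) = fun x => MulAction.toPermHom G _ (m x) :=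
    funext h.signedAct_cosetColoring
  refine ⟨fun c => ?_, fun w => ?_, fun x => ?_⟩
  · rw [key]
    change CosetQuandle.mk (signed s y) _ _ = m (D.overArc c) • CosetQuandle.mk (signed s y) _ _
    rw [CosetQuandle.smul_mk, ← D.edge_left c, CosetQuandle.mk_eq_mk, zpowers_signed]
    exact h.crossing c
  · rw [key, ← map_vertexWord, h.vertex, map_one]
  · rw [key, ← map_pow, h.power, map_one]

/-- The map from the `N`-quandle to the coset quandle. -/
def IsMeridianSystem.toCoset (h : D.IsMeridianSystem N y γ m) (s : D.Edge → Bool) :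
    D.ReorientedNQuandle s N → CosetQuandle (signed s y) :=
  PresentedQuandle.lift (cosetColoring y γ s) h.isColoring.eval_eq

section Action

variable (h : D.IsMeridianSystem N y γ m) (hm : Subgroup.closure (Set.range m) = ⊤)
  (ρ : G →* Equiv.Perm (D.ReorientedNQuandle s N))
  (hρ : ∀ x, ρ (m x) = D.signedAct s (D.reorientedGen s N) x)

-- It suffices to check the generators `m x`, which act on both sides through the symmetry at the
-- arc `x`, and `toCoset` is a quandle homomorphism.
include h hm hρ in
theorem IsMeridianSystem.toCoset_apply (g : G) (q : D.ReorientedNQuandle s N) :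
    h.toCoset s (ρ g q) = g • h.toCoset s q := by
  have hg : g ∈ Subgroup.closure (Set.range m) := hm ▸ Subgroup.mem_top g
  induction hg using Subgroup.closure_induction generalizing q with
  | mem g hg =>
    obtain ⟨x, rfl⟩ := hg
    have key := DFunLike.congr_fun (h.signedAct_cosetColoring (s := s) x) (h.toCoset s q)
    refine Eq.trans ?_ key
    rw [hρ, signedAct, signedAct]
    split
    · exact PresentedQuandle.lift_invAct (cosetColoring y γ s) h.isColoring.eval_eq
        (D.reorientedGen s N x) q
    · exact PresentedQuandle.lift_act (cosetColoring y γ s) h.isColoring.eval_eq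
        (D.reorientedGen s N x) q
  | one => rw [map_one, one_smul]; rfl
  | mul g g' _ _ ih ih' => rw [map_mul, Equiv.Perm.mul_apply, ih, ih', mul_smul]
  | inv g _ ih =>
    rw [eq_inv_smul_iff, ← ih, ← Equiv.Perm.mul_apply, ← map_mul, mul_inv_cancel, map_one]
    rfl

include hm hρ in
theorem quandleInn_eq_range : quandleInn (D.ReorientedNQuandle s N) = ρ.range := by
  apply le_antisymm
  · rw [PresentedQuandle.quandleInn_eq_closure, Subgroup.closure_le]
    rintro _ ⟨x, rfl⟩
    have hx := hρ x
    unfold signedAct at hx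
    split at hx
    · exact ⟨(m x)⁻¹, by rw [map_inv, hx, inv_inv]⟩
    · exact ⟨m x, hx⟩
  · rw [MonoidHom.range_eq_map, ← hm, MonoidHom.map_closure, Subgroup.closure_le]
    rintro _ ⟨_, ⟨x, rfl⟩, rfl⟩
    have hmem : Rack.act' (D.reorientedGen s N x) ∈ quandleInn (D.ReorientedNQuandle s N) :=
      Subgroup.subset_closure ⟨_, rfl⟩
    rw [hρ]
    unfold signedAct
    split
    · exact inv_mem hmem
    · exact hmem

include hm hρ in
theorem mem_component_iff (q r : D.ReorientedNQuandle s N) :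
    q ∈ quandleComponent r ↔ ∃ g, ρ g r = q := by
  constructor
  · rintro ⟨⟨f, hf⟩, rfl⟩
    rw [quandleInn_eq_range hm ρ hρ] at hf
    obtain ⟨g, rfl⟩ := hf
    exact ⟨g, rfl⟩
  · rintro ⟨g, rfl⟩
    exact ⟨⟨ρ g, by rw [quandleInn_eq_range hm ρ hρ]; exact ⟨g, rfl⟩⟩, rfl⟩

-- `G` preserves the index of the coset space, so this index is an invariant that tells components
-- of different edges apart.
include h hm hρ in
theorem IsMeridianSystem.toCoset_fst_of_mem {q : D.ReorientedNQuandle s N} {x : D.Arc}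
    (hq : q ∈ quandleComponent (D.reorientedGen s N x)) : (h.toCoset s q).1 = D.edge x := by
  obtain ⟨g, rfl⟩ := (mem_component_iff hm ρ hρ _ _).1 hq
  rw [h.toCoset_apply hm ρ hρ]
  rfl

-- Orbit-stabilizer. Idempotence puts the meridian into the stabilizer; the coset quandle, where the
-- arc goes to the trivial coset as `γ x = 1`, bounds the stabilizer from above.
include h hm hρ in
theorem IsMeridianSystem.card_component (x : D.Arc) (hx : γ x = 1) :
    Nat.card (quandleComponent (D.reorientedGen s N x)) * orderOf (y (D.edge x)) =
      Nat.card G := by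
  let q := D.reorientedGen s N x
  let _ : MulAction G (D.ReorientedNQuandle s N) := MulAction.compHom _ ρ
  have h₁ : quandleComponent q = MulAction.orbit G q :=
    Set.ext fun r => mem_component_iff hm ρ hρ r q
  have hfix : D.signedAct s (D.reorientedGen s N) x q = q := by
    unfold signedAct
    split
    · exact (Equiv.Perm.inv_eq_iff_eq).2 (Quandle.fix (x := q)).symm
    · exact Quandle.fix (x := q)
  have h₂ : MulAction.stabilizer G q = Subgroup.zpowers (y (D.edge x)) := by
    apply le_antisymm
    · intro g hg
      rw [← zpowers_signed (s := s)]
      have hg' : ρ g q = q := hg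
      apply CosetQuandle.mem_zpowers_of_smul_mk
      have := h.toCoset_apply hm ρ hρ g q
      rw [hg'] at this
      have hq : h.toCoset s q = CosetQuandle.mk _ (D.edge x) 1 := by
        rw [← hx]
        rfl
      rw [← hq, ← this]
    · rw [Subgroup.zpowers_le]
      have hy : m x = y (D.edge x) := by rw [h.conj, hx]; group
      change ρ _ q = q
      rw [← hy, hρ, hfix]
  rw [← Nat.card_zpowers, ← h₂, h₁, Nat.card_congr (MulAction.orbitEquivQuotientStabilizer G q)]
  exact (MulAction.stabilizer G q).index_mul_card

end Action

end SpatialGraphDiagram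

/-! ### Generalized dihedral groups -/

/-- The generalized dihedral group of an abelian group: pairs of a translation part and a sign. -/
@[ext] structure GenDihedral (A : Type) : Type where
  /-- the translation part -/
  trans : A
  /-- the sign -/
  sign : ℤˣ

namespace GenDihedral

theorem natCard_eq (A : Type) : Nat.card (GenDihedral A) = Nat.card A * 2 := by
  let e : GenDihedral A ≃ A × ℤˣ :=
    ⟨fun x => (x.trans, x.sign), fun p => ⟨p.1, p.2⟩, fun _ => rfl, fun _ => rfl⟩
  rw [Nat.card_congr e, Nat.card_prod, Nat.card_eq_fintype_card (α := ℤˣ)]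
  rfl

variable {A : Type} [AddCommGroup A]

instance : Group (GenDihedral A) where
  mul x y := ⟨x.trans + x.sign • y.trans, x.sign * y.sign⟩
  one := ⟨0, 1⟩
  inv x := ⟨-(x.sign • x.trans), x.sign⟩
  mul_assoc x y z := by
    ext
    · change x.trans + x.sign • y.trans + (x.sign * y.sign) • z.trans =
        x.trans + x.sign • (y.trans + y.sign • z.trans)
      rw [smul_add, mul_smul, add_assoc]
    · exact congrArg _ (mul_assoc x.sign y.sign z.sign)
  one_mul x := by
    ext
    · change 0 + (1 : ℤˣ) • x.trans = x.trans
      rw [one_smul, zero_add]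
    · exact congrArg _ (one_mul x.sign)
  mul_one x := by
    ext
    · change x.trans + x.sign • (0 : A) = x.trans
      rw [smul_zero, add_zero]
    · exact congrArg _ (mul_one x.sign)
  inv_mul_cancel x := by
    ext
    · change -(x.sign • x.trans) + x.sign • x.trans = 0
      exact neg_add_cancel _
    · exact congrArg _ (Int.units_mul_self x.sign)

theorem mk_mul_mk (a b : A) (δ ε : ℤˣ) :
    (⟨a, δ⟩ * ⟨b, ε⟩ : GenDihedral A) = ⟨a + δ • b, δ * ε⟩ := rfl

theorem mk_inv (a : A) (δ : ℤˣ) : (⟨a, δ⟩⁻¹ : GenDihedral A) = ⟨-(δ • a), δ⟩ := rfl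

theorem one_def : (1 : GenDihedral A) = ⟨0, 1⟩ := rfl

theorem reflection_sq (a : A) : (⟨a, -1⟩ : GenDihedral A) ^ 2 = 1 := by
  rw [sq, mk_mul_mk, one_def]
  simp

theorem translation_zpow (a : A) (i : ℤ) : (⟨a, 1⟩ : GenDihedral A) ^ i = ⟨i • a, 1⟩ := by
  let f : Multiplicative A →* GenDihedral A :=
    { toFun := fun x => ⟨x.toAdd, 1⟩
      map_one' := rfl
      map_mul' := fun x y => by rw [mk_mul_mk]; simp }
  exact (map_zpow f (Multiplicative.ofAdd a) i).symm

theorem translation_pow (a : A) (i : ℕ) : (⟨a, 1⟩ : GenDihedral A) ^ i = ⟨i • a, 1⟩ := by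
  rw [← zpow_natCast, translation_zpow, natCast_zsmul]

theorem orderOf_reflection (a : A) : orderOf (⟨a, -1⟩ : GenDihedral A) = 2 := by
  refine orderOf_eq_prime (reflection_sq a) fun h => ?_
  exact absurd (congrArg sign h) (show (-1 : ℤˣ) ≠ 1 by decide)

theorem orderOf_translation (a : A) : orderOf (⟨a, 1⟩ : GenDihedral A) = addOrderOf a := by
  refine Nat.dvd_antisymm ?_ ?_
  · rw [orderOf_dvd_iff_pow_eq_one, translation_pow, addOrderOf_nsmul_eq_zero]
    rfl
  · rw [addOrderOf_dvd_iff_nsmul_eq_zero]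
    have h := pow_orderOf_eq_one (⟨a, 1⟩ : GenDihedral A)
    rw [translation_pow] at h
    exact congrArg trans h

/-- The homomorphism given by its values on translations and on the reflection in `0`. -/
def lift {H : Type} [Group H] (f : A →+ Additive H) (r : H) (hr : r * r = 1)
    (hf : ∀ a, r * (f a).toMul * r = (f (-a)).toMul) : GenDihedral A →* H where
  toFun x := (f x.trans).toMul * if x.sign = 1 then 1 else r
  map_one' := by
    change (f 0).toMul * _ = 1
    rw [map_zero]
    exact (one_mul _).trans (if_pos rfl)
  map_mul' := by
    rintro ⟨a, δ⟩ ⟨b, ε⟩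
    have hf' (a : A) : r * (f a).toMul = (f (-a)).toMul * r := by
      rw [← hf, mul_assoc _ r r, hr, mul_one]
    rw [mk_mul_mk]
    rcases Int.units_eq_one_or δ with rfl | rfl <;> rcases Int.units_eq_one_or ε with rfl | rfl
    · simp
    · simp [mul_assoc]
    · simp [mul_assoc, hf']
    · have hb : (-1 : ℤˣ) • b = -b := by simp
      rw [hb, map_add, toMul_add, neg_mul_neg, mul_one, if_pos rfl,
        if_neg (show (-1 : ℤˣ) ≠ 1 by decide), mul_one, mul_assoc, ← mul_assoc r, hf', mul_assoc,
        hr, mul_one]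

theorem lift_translation {H : Type} [Group H] (f : A →+ Additive H) (r : H) (hr hf) (a : A) :
    lift f r hr hf ⟨a, 1⟩ = (f a).toMul := mul_one _

theorem lift_reflection {H : Type} [Group H] (f : A →+ Additive H) (r : H) (hr hf) (a : A) :
    lift f r hr hf ⟨a, -1⟩ = (f a).toMul * r := rfl

end GenDihedral

/-! ### The lattice of relations between the two rotations -/

/-- The lattice generated by `(0, n)` and `(k * m, -m)`. -/
def twistLattice (k m n : ℕ) : AddSubgroup (ℤ × ℤ) :=
  AddSubgroup.closure {((0 : ℤ), (n : ℤ)), ((k * m : ℤ), (-m : ℤ))}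

theorem mem_twistLattice {k m n : ℕ} {p : ℤ × ℤ} :
    p ∈ twistLattice k m n ↔ ∃ i j : ℤ, j * (k * m) = p.1 ∧ i * n - j * m = p.2 := by
  rw [twistLattice, AddSubgroup.mem_closure_pair]
  refine exists_congr fun i => exists_congr fun j => ?_
  rw [Prod.ext_iff]
  simp [sub_eq_add_neg]

/-- The group of translations. -/
abbrev TwistTrans (k m n : ℕ) : Type := (ℤ × ℤ) ⧸ twistLattice k m n

/-- The projection onto the group of translations. -/
def twistMk (k m n : ℕ) : ℤ × ℤ →+ TwistTrans k m n := QuotientAddGroup.mk' _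

theorem twistMk_eq_zero {k m n : ℕ} {p : ℤ × ℤ} : twistMk k m n p = 0 ↔ p ∈ twistLattice k m n :=
  QuotientAddGroup.eq_zero_iff p

theorem twistMk_surjective (k m n : ℕ) : Function.Surjective (twistMk k m n) :=
  QuotientAddGroup.mk'_surjective _

/-- The two lattice generators are in triangular form, so a box of size `k * m` by `n` is a
fundamental domain. -/
theorem natCard_twistTrans {k m n : ℕ} (hk : 0 < k) (hm : 0 < m) (hn : 0 < n) :
    Nat.card (TwistTrans k m n) = k * m * n := by
  have hkm : (0 : ℤ) < k * m := by positivity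
  have hn' : (0 : ℤ) < n := by positivity
  let f (p : Fin (k * m) × Fin n) : TwistTrans k m n := twistMk k m n ((p.1 : ℤ), (p.2 : ℤ))
  have hf : Function.Bijective f := by
    constructor
    · rintro ⟨⟨x, hx⟩, ⟨y, hy⟩⟩ ⟨⟨x', hx'⟩, ⟨y', hy'⟩⟩ h
      have h' := sub_eq_zero.2 h
      simp only [f, ← map_sub] at h'
      obtain ⟨i, j, h₁, h₂⟩ := mem_twistLattice.1 (twistMk_eq_zero.1 h')
      simp only [Prod.fst_sub, Prod.snd_sub] at h₁ h₂
      have hx₂ : (x : ℤ) < k * m := by exact_mod_cast hx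
      have hx₂' : (x' : ℤ) < k * m := by exact_mod_cast hx'
      have hj : j = 0 := by
        have h₃ : j < 1 := by nlinarith
        have h₄ : -1 < j := by nlinarith
        omega
      subst hj
      have hi : i = 0 := by
        have h₃ : i < 1 := by nlinarith
        have h₄ : -1 < i := by nlinarith
        omega
      subst hi
      simp only [Prod.mk.injEq, Fin.mk.injEq]
      omega
    · intro a
      obtain ⟨⟨x, y⟩, rfl⟩ := twistMk_surjective k m n a
      -- Subtracting `q` times `(k * m, -m)` reduces the first coordinate and turns the second into
      -- `z = y + q * m`, which is then reduced modulo `n`.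
      let q := x / (k * m : ℤ)
      obtain ⟨z, hz⟩ : ∃ z, z = y + q * m := ⟨_, rfl⟩
      have h₁ := Int.emod_nonneg x hkm.ne'
      have h₂ := Int.emod_lt_of_pos x hkm
      have h₃ := Int.emod_nonneg z hn'.ne'
      have h₄ := Int.emod_lt_of_pos z hn'
      refine ⟨(⟨(x % (k * m : ℤ)).toNat, by zify; rwa [Int.toNat_of_nonneg h₁]⟩,
        ⟨(z % n).toNat, by zify; rwa [Int.toNat_of_nonneg h₃]⟩), ?_⟩
      rw [← sub_eq_zero]
      simp only [f, ← map_sub]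
      rw [twistMk_eq_zero, mem_twistLattice]
      refine ⟨-(z / n), -q, ?_, ?_⟩
      · rw [Prod.fst_sub, Int.toNat_of_nonneg h₁, Int.emod_def]
        ring
      · rw [Prod.snd_sub, Int.toNat_of_nonneg h₃]
        linear_combination -Int.emod_add_mul_ediv z n - hz
  rw [← Nat.card_eq_of_bijective f hf]
  simp

/-- `m` times this vector is a lattice generator, and first coordinates of lattice vectors are
multiples of `k * m`. -/
theorem addOrderOf_twistMk_c {k m n : ℕ} (hk : 0 < k) :
    addOrderOf (twistMk k m n (k, -1)) = m := by
  refine Nat.dvd_antisymm ?_ ?_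
  · rw [addOrderOf_dvd_iff_nsmul_eq_zero, ← map_nsmul, twistMk_eq_zero, mem_twistLattice]
    refine ⟨0, 1, ?_, ?_⟩
    · simp; ring
    · simp
  · have h := addOrderOf_nsmul_eq_zero (twistMk k m n (k, -1))
    rw [← map_nsmul, twistMk_eq_zero, mem_twistLattice] at h
    obtain ⟨i, j, h₁, -⟩ := h
    rw [Prod.smul_fst, nsmul_eq_mul] at h₁
    rw [← Int.natCast_dvd_natCast]
    refine ⟨j, ?_⟩
    have hk' : (k : ℤ) ≠ 0 := by positivity
    apply mul_right_cancel₀ hk'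
    rw [← h₁]
    ring

/-- A lattice vector with first coordinate `0` is a multiple of `(0, n)`. -/
theorem addOrderOf_twistMk_d {k m n : ℕ} (hk : 0 < k) (hm : 0 < m) :
    addOrderOf (twistMk k m n (0, 1)) = n := by
  refine Nat.dvd_antisymm ?_ ?_
  · rw [addOrderOf_dvd_iff_nsmul_eq_zero, ← map_nsmul, twistMk_eq_zero, mem_twistLattice]
    exact ⟨1, 0, by simp, by simp⟩
  · have h := addOrderOf_nsmul_eq_zero (twistMk k m n (0, 1))
    rw [← map_nsmul, twistMk_eq_zero, mem_twistLattice] at h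
    obtain ⟨i, j, h₁, h₂⟩ := h
    rw [Prod.smul_fst, smul_zero] at h₁
    rw [Prod.smul_snd, nsmul_one] at h₂
    have hkm : (k * m : ℤ) ≠ 0 := by positivity
    obtain rfl := (mul_eq_zero.1 h₁).resolve_right hkm
    rw [← Int.natCast_dvd_natCast]
    exact ⟨i, by rw [← h₂]; ring⟩

/-! ### Consequences of the crossing relations for symmetries and components -/

namespace SpatialGraphDiagram

variable {D : SpatialGraphDiagram} {s : D.Edge → Bool} {N : D.Edge → ℕ}

/-- The two under-arcs lie on one edge, so their symmetries carry the same sign and the conjugacy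
survives reorientation. -/
theorem IsColoring.signedAct_leftArc {M : Type} [Quandle M] {v : D.Arc → M}
    (h : D.IsColoring s N v) (c : D.Crossing) :
    D.signedAct s v (D.leftArc c) = D.signedAct s v (D.overArc c) * D.signedAct s v (D.rightArc c) *
      (D.signedAct s v (D.overArc c))⁻¹ := by
  have key : (Rack.act' (v (D.leftArc c)) : Equiv.Perm M) = D.signedAct s v (D.overArc c) *
      Rack.act' (v (D.rightArc c)) * (D.signedAct s v (D.overArc c))⁻¹ := by
    rw [h.crossing c]
    rcases Bool.eq_false_or_eq_true (s (D.edge (D.overArc c))) with hs | hs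
    · simp only [signedAct, hs, if_true, inv_inv]
      have := Rack.ad_conj (v (D.overArc c)) (v (D.overArc c) ◃⁻¹ v (D.rightArc c))
      rw [Rack.right_inv] at this
      rw [this]
      change Rack.act' (v (D.overArc c) ◃⁻¹ v (D.rightArc c)) = _
      group
    · simp only [signedAct, hs, Bool.false_eq_true, if_false]
      exact Rack.ad_conj _ _
  have hr : D.signedAct s v (D.rightArc c) = if s (D.edge (D.leftArc c)) then
      (Rack.act' (v (D.rightArc c)))⁻¹ else Rack.act' (v (D.rightArc c)) := by
    rw [D.edge_left]
    rfl
  have hl : D.signedAct s v (D.leftArc c) = if s (D.edge (D.leftArc c)) then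
      (Rack.act' (v (D.leftArc c)))⁻¹ else Rack.act' (v (D.leftArc c)) := rfl
  rw [hr, hl, key]
  split
  · group
  · rfl

theorem component_leftArc (c : D.Crossing) :
    quandleComponent (D.reorientedGen s N (D.leftArc c)) =
      quandleComponent (D.reorientedGen s N (D.rightArc c)) := by
  unfold quandleComponent
  rw [MulAction.orbit_eq_iff, isColoring_reorientedGen.crossing c]
  have hmem : Rack.act' (D.reorientedGen s N (D.overArc c)) ∈
      quandleInn (D.ReorientedNQuandle s N) := Subgroup.subset_closure ⟨_, rfl⟩
  unfold signedAct
  split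
  · exact ⟨⟨_, inv_mem hmem⟩, rfl⟩
  · exact ⟨⟨_, hmem⟩, rfl⟩

end SpatialGraphDiagram

/-! ### The Wirtinger group of the twisted band -/

/-- The Wirtinger and power relations of the twisted band, in the order of composition of left
actions. -/
structure TwistRelations {H : Type} [Group H] (k m n : ℕ) (μ : TwistArc k → H) : Prop where
  s_sq (i : Fin (k + 2)) : μ (.s i) * μ (.s i) = 1
  e_sq : μ .e * μ .e = 1
  f_sq : μ .f * μ .f = 1
  c_pow : μ .c ^ m = 1
  d_pow : μ .d ^ n = 1
  crossing (j : ℕ) (hj : j < k) : μ (.s ⟨j + 2, by omega⟩) =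
    μ (.s ⟨j + 1, by omega⟩) * μ (.s ⟨j, by omega⟩) * μ (.s ⟨j + 1, by omega⟩)
  s_one : μ (.s ⟨1, by omega⟩) = μ .e * μ .d
  s_zero : μ (.s ⟨0, by omega⟩) = μ .f * μ .d
  c_eq : μ .c = μ (.s ⟨k, by omega⟩) * μ .f

/-- As the elements of `a`, `b`, `e`, `f` are involutions, the directions of these edges do not
matter and the crossing relations take one form for both parities. The relation at `v₃` follows from
the others and is not listed. -/
theorem twistRelations_signedAct {k m n : ℕ} {s : TwistEdge → Bool} {M : Type} [Quandle M]
    {v : TwistArc k → M} (h : (twistDiagram k).IsColoring s (twistLabel m n) v) :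
    TwistRelations k m n ((twistDiagram k).signedAct s v) := by
  set μ := (twistDiagram k).signedAct s v with hμ
  have hs (i : Fin (k + 2)) : μ (.s i) * μ (.s i) = 1 := by
    have hi := h.power (.s i)
    have hN : twistLabel m n ((twistDiagram k).edge (.s i)) = 2 := by
      change twistLabel m n (if i.val % 2 = 0 then .b else .a) = 2
      split <;> rfl
    rw [hN, sq] at hi
    exact hi
  have hinv (i : Fin (k + 2)) : (μ (.s i))⁻¹ = μ (.s i) := inv_eq_of_mul_eq_one_left (hs i)
  have he : μ .e * μ .e = 1 := (sq _).symm.trans (h.power .e)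
  have hf : μ .f * μ .f = 1 := (sq _).symm.trans (h.power .f)
  have hfinv : (μ .f)⁻¹ = μ .f := inv_eq_of_mul_eq_one_left hf
  refine ⟨hs, he, hf, h.power .c, h.power .d, fun j hj => ?_, ?_, ?_, ?_⟩
  · have hc := h.signedAct_leftArc (⟨j, hj⟩ : Fin k)
    by_cases hpar : (j + 1) % 2 = 0
    · have h₁ : (twistDiagram k).leftArc (⟨j, hj⟩ : Fin k) = .s ⟨j, by omega⟩ := if_pos hpar
      have h₂ : (twistDiagram k).rightArc (⟨j, hj⟩ : Fin k) = .s ⟨j + 2, by omega⟩ := if_pos hpar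
      rw [h₁, h₂] at hc
      change μ (.s ⟨j, _⟩) = μ (.s ⟨j + 1, _⟩) * μ (.s ⟨j + 2, _⟩) * (μ (.s ⟨j + 1, _⟩))⁻¹ at hc
      rw [hc]
      nth_rewrite 1 [← hinv ⟨j + 1, by omega⟩]
      group
    · have h₁ : (twistDiagram k).leftArc (⟨j, hj⟩ : Fin k) = .s ⟨j + 2, by omega⟩ := if_neg hpar
      have h₂ : (twistDiagram k).rightArc (⟨j, hj⟩ : Fin k) = .s ⟨j, by omega⟩ := if_neg hpar
      rw [h₁, h₂] at hc
      change μ (.s ⟨j + 2, _⟩) = μ (.s ⟨j + 1, _⟩) * μ (.s ⟨j, _⟩) * (μ (.s ⟨j + 1, _⟩))⁻¹ at hc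
      rw [hc, hinv]
  · have hv : (μ (.s ⟨1, by omega⟩))⁻¹ * (μ .e * (μ .d * 1)) = 1 := h.vertex TwistVertex.v₁
    rw [mul_one] at hv
    exact inv_mul_eq_one.1 hv
  · have hv : (μ .d)⁻¹ * ((μ .f)⁻¹ * (μ (.s ⟨0, by omega⟩) * 1)) = 1 := h.vertex TwistVertex.v₂
    rw [mul_one, inv_mul_eq_one, eq_inv_mul_iff_mul_eq] at hv
    exact hv.symm
  · have hv := h.vertex TwistVertex.v₄
    rcases Nat.mod_two_eq_zero_or_one k with hk | hk
    · have hd : decide (k % 2 = 1) = false := by simp [hk]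
      have hv' : (μ .c)⁻¹ * ((if decide (k % 2 = 1) = true then μ (.s ⟨k, by omega⟩) else
          (μ (.s ⟨k, by omega⟩))⁻¹) * (μ .f * 1)) = 1 := hv
      rw [hd, if_neg Bool.false_ne_true, hinv, mul_one, inv_mul_eq_one] at hv'
      exact hv'
    · have hd : decide (k % 2 = 1) = true := by simp [hk]
      have hv' : (μ .c)⁻¹ * ((if decide (k % 2 = 1) = true then μ (.s ⟨k, by omega⟩) else
          (μ (.s ⟨k, by omega⟩))⁻¹) * (μ .f * 1)) = 1 := hv
      rw [hd, if_pos rfl, mul_one, inv_mul_eq_one] at hv'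
      exact hv'

/-! ### The generalized dihedral model, its meridians and its presentation -/

/-- The group that the arcs generate. -/
abbrev TwistGroup (k m n : ℕ) : Type := GenDihedral (TwistTrans k m n)

/-- The translation `(i, j)`. -/
def twistRot (k m n : ℕ) (i j : ℤ) : TwistGroup k m n := ⟨twistMk k m n (i, j), 1⟩

/-- The reflection that is the product of the translation `(i, j)` and the reflection in `0`. -/
def twistRefl (k m n : ℕ) (i j : ℤ) : TwistGroup k m n := ⟨twistMk k m n (i, j), -1⟩

section TwistGroup

variable {k m n : ℕ}

theorem twistRot_mul_twistRot (i j i' j' : ℤ) :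
    twistRot k m n i j * twistRot k m n i' j' = twistRot k m n (i + i') (j + j') := by
  rw [twistRot, twistRot, GenDihedral.mk_mul_mk, one_smul, ← map_add]
  rfl

theorem twistRot_mul_twistRefl (i j i' j' : ℤ) :
    twistRot k m n i j * twistRefl k m n i' j' = twistRefl k m n (i + i') (j + j') := by
  rw [twistRot, twistRefl, GenDihedral.mk_mul_mk, one_smul, ← map_add, one_mul]
  rfl

theorem twistRefl_mul_twistRot (i j i' j' : ℤ) :
    twistRefl k m n i j * twistRot k m n i' j' = twistRefl k m n (i - i') (j - j') := by
  rw [twistRot, twistRefl, GenDihedral.mk_mul_mk, Units.neg_smul, one_smul, ← sub_eq_add_neg,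
    ← map_sub, mul_one]
  rfl

theorem twistRefl_mul_twistRefl (i j i' j' : ℤ) :
    twistRefl k m n i j * twistRefl k m n i' j' = twistRot k m n (i - i') (j - j') := by
  rw [twistRefl, twistRefl, GenDihedral.mk_mul_mk, Units.neg_smul, one_smul, ← sub_eq_add_neg,
    ← map_sub, neg_mul_neg, mul_one]
  rfl

theorem twistRot_inv (i j : ℤ) : (twistRot k m n i j)⁻¹ = twistRot k m n (-i) (-j) := by
  rw [twistRot, GenDihedral.mk_inv, one_smul, ← map_neg]
  rfl

theorem twistRefl_inv (i j : ℤ) : (twistRefl k m n i j)⁻¹ = twistRefl k m n i j := by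
  rw [twistRefl, GenDihedral.mk_inv, Units.neg_smul, one_smul, neg_neg]

theorem twistRot_zero : twistRot k m n 0 0 = 1 := by
  rw [twistRot, GenDihedral.one_def, ← Prod.zero_eq_mk, map_zero]

theorem twistRot_zpow (i j l : ℤ) :
    twistRot k m n i j ^ l = twistRot k m n (l * i) (l * j) := by
  rw [twistRot, GenDihedral.translation_zpow, ← map_zsmul]
  rfl

/-- The group elements of the edges at their base points. -/
def twistMeridian (k m n : ℕ) : TwistEdge → TwistGroup k m n
  | .a => twistRefl k m n 1 0
  | .b => twistRefl k m n 0 0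
  | .c => twistRot k m n k (-1)
  | .d => twistRot k m n 0 1
  | .e => twistRefl k m n 1 1
  | .f => twistRefl k m n 0 1

/-- The group elements of the arcs. -/
def twistArcMeridian (k m n : ℕ) : TwistArc k → TwistGroup k m n
  | .s i => twistRefl k m n i.val 0
  | .c => twistRot k m n k (-1)
  | .d => twistRot k m n 0 1
  | .e => twistRefl k m n 1 1
  | .f => twistRefl k m n 0 1

/-- The translations that bring the base points of the edges to the arcs. -/
def twistTransport (k m n : ℕ) : TwistArc k → TwistGroup k m n
  | .s i => twistRot k m n (i.val / 2 : ℕ) 0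
  | _ => 1

theorem orderOf_twistMeridian_c (hk : 0 < k) : orderOf (twistMeridian k m n .c) = m :=
  (GenDihedral.orderOf_translation _).trans (addOrderOf_twistMk_c hk)

theorem orderOf_twistMeridian_d (hk : 0 < k) (hm : 0 < m) :
    orderOf (twistMeridian k m n .d) = n :=
  (GenDihedral.orderOf_translation _).trans (addOrderOf_twistMk_d hk hm)

theorem orderOf_twistRefl (i j : ℤ) : orderOf (twistRefl k m n i j) = 2 :=
  GenDihedral.orderOf_reflection _

theorem orderOf_twistMeridian (hk : 0 < k) (hm : 0 < m) (u : TwistEdge) :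
    orderOf (twistMeridian k m n u) = twistLabel m n u := by
  cases u with
  | c => exact orderOf_twistMeridian_c hk
  | d => exact orderOf_twistMeridian_d hk hm
  | a | b | e | f => exact orderOf_twistRefl _ _

/-- Conjugation by the translation `(t, 0)` moves a reflection by `(2 * t, 0)`; thus `i / 2` steps
lead from the base arc of the same parity to `s i`. -/
theorem twistArcMeridian_eq_conj (x : TwistArc k) : twistArcMeridian k m n x =
    twistTransport k m n x * twistMeridian k m n x.edge * (twistTransport k m n x)⁻¹ := by
  cases x with
  | s i =>
    rcases Nat.mod_two_eq_zero_or_one i.val with hi | hi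
    · have hu : (TwistArc.s i).edge = TwistEdge.b := if_pos hi
      rw [hu, twistArcMeridian, twistTransport, twistMeridian, twistRot_mul_twistRefl, twistRot_inv,
        twistRefl_mul_twistRot]
      congr 1
      omega
    · have hu : (TwistArc.s i).edge = TwistEdge.a := if_neg (by omega)
      rw [hu, twistArcMeridian, twistTransport, twistMeridian, twistRot_mul_twistRefl, twistRot_inv,
        twistRefl_mul_twistRot]
      congr 1
      omega
  | c | d | e | f =>
    exact ((congrArg _ inv_one).trans ((mul_one _).trans (one_mul _))).symm

theorem isMeridianSystem_twist (hk : 0 < k) (hm : 0 < m) :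
    (twistDiagram k).IsMeridianSystem (twistLabel m n) (twistMeridian k m n)
      (twistTransport k m n) (twistArcMeridian k m n) where
  conj := twistArcMeridian_eq_conj
  crossing c := by
    obtain ⟨j, hj⟩ : Fin k := c
    by_cases hpar : (j + 1) % 2 = 0
    · have h₁ : (twistDiagram k).leftArc (⟨j, hj⟩ : Fin k) = .s ⟨j, by omega⟩ := if_pos hpar
      have h₂ : (twistDiagram k).rightArc (⟨j, hj⟩ : Fin k) = .s ⟨j + 2, by omega⟩ := if_pos hpar
      have hu : (twistDiagram k).edge (.s ⟨j, by omega⟩) = TwistEdge.a :=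
        if_neg (show ¬ j % 2 = 0 by omega)
      rw [h₁, h₂, hu]
      -- For odd `j`, `j + 1 - (j + 2) / 2 - j / 2 = 1`, so the element is the meridian of `a`
      -- itself; for even `j` the value is `0`, which gives `b`.
      convert Subgroup.mem_zpowers (twistMeridian k m n .a) using 1
      change (twistRot k m n (j / 2 : ℕ) 0)⁻¹ * (twistRefl k m n (j + 1 : ℕ) 0 *
        twistRot k m n ((j + 2) / 2 : ℕ) 0) = twistRefl k m n 1 0
      rw [twistRefl_mul_twistRot, twistRot_inv, twistRot_mul_twistRefl]
      congr 1
      omega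
    · have h₁ : (twistDiagram k).leftArc (⟨j, hj⟩ : Fin k) = .s ⟨j + 2, by omega⟩ := if_neg hpar
      have h₂ : (twistDiagram k).rightArc (⟨j, hj⟩ : Fin k) = .s ⟨j, by omega⟩ := if_neg hpar
      have hu : (twistDiagram k).edge (.s ⟨j + 2, by omega⟩) = TwistEdge.b :=
        if_pos (show (j + 2) % 2 = 0 by omega)
      rw [h₁, h₂, hu]
      convert Subgroup.mem_zpowers (twistMeridian k m n .b) using 1
      change (twistRot k m n ((j + 2) / 2 : ℕ) 0)⁻¹ * (twistRefl k m n (j + 1 : ℕ) 0 *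
        twistRot k m n (j / 2 : ℕ) 0) = twistRefl k m n 0 0
      rw [twistRefl_mul_twistRot, twistRot_inv, twistRot_mul_twistRefl]
      congr 1
      omega
  vertex w := by
    cases (w : TwistVertex) with
    | v₁ =>
      change (twistRefl k m n (1 : ℕ) 0)⁻¹ * (twistRefl k m n 1 1 * (twistRot k m n 0 1 * 1)) = 1
      simp [twistRefl_inv, twistRefl_mul_twistRot, twistRefl_mul_twistRefl, twistRot_zero]
    | v₂ =>
      change (twistRot k m n 0 1)⁻¹ * ((twistRefl k m n 0 1)⁻¹ *
        (twistRefl k m n (0 : ℕ) 0 * 1)) = 1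
      simp [twistRefl_inv, twistRefl_mul_twistRefl]
    | v₃ =>
      change (twistRefl k m n 1 1)⁻¹ * ((if decide ((k + 1) % 2 = 1) = true then
        twistRefl k m n (k + 1 : ℕ) 0 else (twistRefl k m n (k + 1 : ℕ) 0)⁻¹) *
          (twistRot k m n k (-1) * 1)) = 1
      -- Both branches of the `if` agree because a reflection is its own inverse.
      simp [twistRefl_inv, twistRefl_mul_twistRot, twistRefl_mul_twistRefl, twistRot_zero]
    | v₄ =>
      change (twistRot k m n k (-1))⁻¹ * ((if decide (k % 2 = 1) = true then
        twistRefl k m n (k : ℕ) 0 else (twistRefl k m n (k : ℕ) 0)⁻¹) *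
          (twistRefl k m n 0 1 * 1)) = 1
      simp [twistRefl_inv, twistRefl_mul_twistRefl]
  power x := by
    obtain ⟨x, rfl⟩ : ∃ z : TwistArc k, z = x := ⟨x, rfl⟩
    change twistArcMeridian k m n x ^ twistLabel m n (TwistArc.edge x) = 1
    rw [twistArcMeridian_eq_conj, conj_pow, ← orderOf_twistMeridian (n := n) hk hm,
      pow_orderOf_eq_one, mul_one, mul_inv_cancel]

/-- The elements of `s 1` and `s 0` multiply to the translation `(1, 0)`, `d` gives `(0, 1)`, and `s
0` gives the reflection in `0`. -/
theorem closure_range_twistArcMeridian :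
    Subgroup.closure (Set.range (twistArcMeridian k m n)) = ⊤ := by
  rw [eq_top_iff]
  rintro ⟨a, δ⟩ -
  obtain ⟨⟨i, j⟩, rfl⟩ := twistMk_surjective k m n a
  have hmem (x : TwistArc k) : twistArcMeridian k m n x ∈
      Subgroup.closure (Set.range (twistArcMeridian k m n)) := Subgroup.subset_closure ⟨x, rfl⟩
  have h₀ := hmem (.s ⟨0, by omega⟩)
  have h₁ := hmem (.s ⟨1, by omega⟩)
  have hrot : twistRot k m n i j ∈ Subgroup.closure (Set.range (twistArcMeridian k m n)) := by
    have h := mul_mem (zpow_mem (mul_mem h₁ h₀) i) (zpow_mem (hmem .d) j)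
    simpa [twistArcMeridian, twistRefl_mul_twistRefl, twistRot_zpow, twistRot_mul_twistRot] using h
  rcases Int.units_eq_one_or δ with rfl | rfl
  · exact hrot
  · have h := mul_mem hrot h₀
    simp only [twistArcMeridian, twistRot_mul_twistRefl, Nat.cast_zero, add_zero] at h
    exact h

theorem natCard_twistGroup (hk : 0 < k) (hm : 0 < m) (hn : 0 < n) :
    Nat.card (TwistGroup k m n) = k * m * n * 2 := by
  rw [GenDihedral.natCard_eq, natCard_twistTrans hk hm hn]

/-- Here `h` is the product of the involutions `g * h⁻¹` and `g`, and a product of two involutions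
is inverted by each of them. -/
theorem semiconjBy_inv_of_mul_self {H : Type} [Group H] {g h : H} (hg : g * g = 1)
    (hgh : g * h⁻¹ * (g * h⁻¹) = 1) : SemiconjBy g h h⁻¹ := by
  have h₁ := inv_eq_of_mul_eq_one_left hgh
  rw [mul_inv_rev, inv_inv, inv_eq_of_mul_eq_one_left hg] at h₁
  change g * h = h⁻¹ * g
  rw [eq_inv_mul_iff_mul_eq, ← mul_assoc, h₁, inv_mul_cancel_right]

/-- The group `TwistGroup k m n` is presented by `TwistRelations k m n`. -/
theorem TwistRelations.exists_hom {H : Type} [Group H] {μ : TwistArc k → H}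
    (h : TwistRelations k m n μ) :
    ∃ ρ : TwistGroup k m n →* H, ∀ x, ρ (twistArcMeridian k m n x) = μ x := by
  obtain ⟨A, hA⟩ : ∃ A, A = μ (.s ⟨1, by omega⟩) := ⟨_, rfl⟩
  obtain ⟨B, hB⟩ : ∃ B, B = μ (.s ⟨0, by omega⟩) := ⟨_, rfl⟩
  obtain ⟨T, hT⟩ : ∃ T, T = A * B := ⟨_, rfl⟩
  obtain ⟨D, hD⟩ : ∃ D, D = μ .d := ⟨_, rfl⟩
  have hAA : A * A = 1 := hA ▸ h.s_sq _
  have hBB : B * B = 1 := hB ▸ h.s_sq _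
  have hF : μ .f = B * D⁻¹ := by rw [hB, hD, h.s_zero, mul_inv_cancel_right]
  have hE : μ .e = A * D⁻¹ := by rw [hA, hD, h.s_one, mul_inv_cancel_right]
  have hBD : SemiconjBy B D D⁻¹ := semiconjBy_inv_of_mul_self hBB (hF ▸ h.f_sq)
  have hAD : SemiconjBy A D D⁻¹ := semiconjBy_inv_of_mul_self hAA (hE ▸ h.e_sq)
  have hBT : SemiconjBy B T T⁻¹ := by
    change B * T = T⁻¹ * B
    rw [hT, mul_inv_rev, inv_eq_of_mul_eq_one_left hAA, inv_eq_of_mul_eq_one_left hBB, mul_assoc]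
  -- `T = A * B` inverts `D` twice.
  have hTD : Commute T D := by
    have h₁ := hAD.inv_right.mul_left hBD
    rwa [inv_inv, ← hT] at h₁
  have hTB : A = T * B := by rw [hT, mul_assoc, hBB, mul_one]
  -- The crossing relation is a recursion of order two, so the induction carries two consecutive
  -- arcs.
  have hS (j : ℕ) (hj : j < k + 1) :
      μ (.s ⟨j, by omega⟩) = T ^ j * B ∧ μ (.s ⟨j + 1, by omega⟩) = T ^ (j + 1) * B := by
    induction j with
    | zero => exact ⟨by rw [pow_zero, one_mul, hB],
        (hA.symm.trans hTB).trans (by rw [zero_add, pow_one])⟩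
    | succ j ih =>
      obtain ⟨ih₁, ih₂⟩ := ih (by omega)
      refine ⟨ih₂, ?_⟩
      have h₁ : B * (T ^ j * B) = (T ^ j)⁻¹ := by
        rw [← mul_assoc, (hBT.pow_right j).eq, mul_assoc, hBB, mul_one, inv_pow]
      have h₂ : T ^ (j + 1) * (T ^ j)⁻¹ = T := by rw [pow_succ', mul_inv_cancel_right]
      rw [h.crossing j (by omega), ih₁, ih₂, mul_assoc (T ^ (j + 1)), h₁, h₂, ← mul_assoc,
        ← pow_succ']
  have hC : μ .c = T ^ k * D⁻¹ := by
    rw [h.c_eq, (hS k (by omega)).1, hF, mul_assoc, ← mul_assoc B, hBB, one_mul]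
  let f₀ : ℤ × ℤ →+ Additive H := AddMonoidHom.mk' (fun p => Additive.ofMul (T ^ p.1 * D ^ p.2))
    fun p q => by
      have h₁ : T ^ (p.1 + q.1) * D ^ (p.2 + q.2) = T ^ p.1 * D ^ p.2 * (T ^ q.1 * D ^ q.2) := by
        rw [zpow_add, zpow_add, mul_assoc, mul_assoc, ← mul_assoc (T ^ q.1),
          ← mul_assoc (D ^ p.2), (hTD.zpow_zpow q.1 p.2).eq]
      exact congrArg Additive.ofMul h₁
  -- The lattice generators express exactly the remaining relations `d ^ n = 1` and `c ^ m = 1`.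
  have hker : twistLattice k m n ≤ f₀.ker := by
    rw [twistLattice, AddSubgroup.closure_le]
    rintro _ (rfl | rfl)
    · change T ^ (0 : ℤ) * D ^ (n : ℤ) = 1
      rw [zpow_zero, one_mul, zpow_natCast, hD, h.d_pow]
    · change T ^ (k * m : ℤ) * D ^ (-m : ℤ) = 1
      rw [zpow_mul, zpow_natCast, zpow_natCast, zpow_neg, zpow_natCast, ← inv_pow,
        ← (hTD.pow_left k).inv_right.mul_pow, ← hC, h.c_pow]
  let f : TwistTrans k m n →+ Additive H := QuotientAddGroup.lift _ f₀ hker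
  have hf (i j : ℤ) : (f (twistMk k m n (i, j))).toMul = T ^ i * D ^ j := rfl
  have hr (a : TwistTrans k m n) : B * (f a).toMul * B = (f (-a)).toMul := by
    obtain ⟨⟨i, j⟩, rfl⟩ := twistMk_surjective k m n a
    rw [← map_neg, Prod.neg_mk, hf, hf, ((hBT.zpow_right i).mul_right (hBD.zpow_right j)).eq,
      mul_assoc, hBB, mul_one, inv_zpow', inv_zpow']
  refine ⟨GenDihedral.lift f B hBB hr, fun x => ?_⟩
  cases x with
  | s i =>
    refine (GenDihedral.lift_reflection _ _ _ _ _).trans ?_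
    rw [hf, zpow_natCast, zpow_zero, mul_one]
    -- The last arc `k + 1` is reached only by the second half of `hS`, at index `k`.
    obtain ⟨_ | i, hi⟩ := i
    · exact (hS 0 (by omega)).1.symm
    · exact (hS i (by omega)).2.symm
  | c =>
    refine (GenDihedral.lift_translation _ _ _ _ _).trans ?_
    rw [hf, hC, zpow_natCast, zpow_neg_one]
  | d =>
    refine (GenDihedral.lift_translation _ _ _ _ _).trans ?_
    rw [hf, hD, zpow_zero, one_mul, zpow_one]
  | e =>
    refine (GenDihedral.lift_reflection _ _ _ _ _).trans ?_
    rw [hf, hE, hTB, zpow_one, zpow_one, mul_assoc, mul_assoc, hBD.inv_right.eq, inv_inv]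
  | f =>
    refine (GenDihedral.lift_reflection _ _ _ _ _).trans ?_
    rw [hf, hF, zpow_zero, one_mul, zpow_one, hBD.inv_right.eq, inv_inv]

end TwistGroup

/-! ### Components and cardinalities -/

/-- The first arc of each edge. -/
def TwistEdge.baseArc (k : ℕ) : TwistEdge → TwistArc k
  | .a => .s ⟨1, by omega⟩
  | .b => .s ⟨0, by omega⟩
  | .c => .c
  | .d => .d
  | .e => .e
  | .f => .f

theorem TwistEdge.edge_baseArc (k : ℕ) (u : TwistEdge) : (u.baseArc k).edge = u := by
  cases u <;> rfl

theorem twistTransport_baseArc (k m n : ℕ) (u : TwistEdge) :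
    twistTransport k m n (u.baseArc k) = 1 := by
  cases u with
  | a =>
    change twistRot k m n ((1 / 2 : ℕ) : ℤ) 0 = 1
    rw [Nat.div_eq_of_lt one_lt_two, Nat.cast_zero, twistRot_zero]
  | b =>
    change twistRot k m n ((0 / 2 : ℕ) : ℤ) 0 = 1
    rw [Nat.zero_div, Nat.cast_zero, twistRot_zero]
  | c | d | e | f => rfl

/-- The number of the edge. -/
def TwistEdge.equivFin : Fin 6 ≃ TwistEdge where
  toFun := ![.a, .b, .c, .d, .e, .f]
  invFun
    | .a => 0
    | .b => 1
    | .c => 2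
    | .d => 3
    | .e => 4
    | .f => 5
  left_inv i := by fin_cases i <;> rfl
  right_inv u := by cases u <;> rfl

theorem natCard_sigma_twistEdge {β : TwistEdge → Type} (hβ : ∀ u, Finite (β u)) :
    Nat.card (Σ u, β u) = Nat.card (β .a) + Nat.card (β .b) + Nat.card (β .c) +
      Nat.card (β .d) + Nat.card (β .e) + Nat.card (β .f) := by
  let _ : Fintype TwistEdge := Fintype.ofEquiv _ TwistEdge.equivFin
  rw [Nat.card_sigma, ← TwistEdge.equivFin.sum_comp, Fin.sum_univ_six]
  rfl

/-- Crossing `j` puts `s j` and `s (j + 2)` into one component; descending by two ends at `s 0` or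
`s 1`. -/
theorem component_eq_component_baseArc {k m n : ℕ} {s : TwistEdge → Bool} (x : TwistArc k) :
    quandleComponent ((twistDiagram k).reorientedGen s (twistLabel m n) x) =
      quandleComponent ((twistDiagram k).reorientedGen s (twistLabel m n) (x.edge.baseArc k)) := by
  cases x with
  | c | d | e | f => rfl
  | s i =>
    obtain ⟨i, hi⟩ := i
    induction i using Nat.strong_induction_on with
    | _ i ih =>
      match i with
      | 0 => rfl
      | 1 => rfl
      | j + 2 =>
        have hedge : (TwistArc.s ⟨j + 2, hi⟩ : TwistArc k).edge =
            (TwistArc.s ⟨j, by omega⟩ : TwistArc k).edge := by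
          simp [TwistArc.edge]
        rw [hedge, ← ih j (by omega) (by omega)]
        have hc := SpatialGraphDiagram.component_leftArc (D := twistDiagram k) (s := s)
          (N := twistLabel m n) (⟨j, by omega⟩ : Fin k)
        by_cases hpar : (j + 1) % 2 = 0
        · have h₁ : (twistDiagram k).leftArc (⟨j, by omega⟩ : Fin k) = .s ⟨j, by omega⟩ :=
            if_pos hpar
          have h₂ : (twistDiagram k).rightArc (⟨j, by omega⟩ : Fin k) = .s ⟨j + 2, by omega⟩ :=
            if_pos hpar
          rw [h₁, h₂] at hc
          exact hc.symm
        · have h₁ : (twistDiagram k).leftArc (⟨j, by omega⟩ : Fin k) = .s ⟨j + 2, by omega⟩ :=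
            if_neg hpar
          have h₂ : (twistDiagram k).rightArc (⟨j, by omega⟩ : Fin k) = .s ⟨j, by omega⟩ :=
            if_neg hpar
          rw [h₁, h₂] at hc
          exact hc

theorem twistComponentCard_mul_twistLabel (k m n : ℕ) (u : TwistEdge) :
    twistComponentCard k m n u * twistLabel m n u = k * m * n * 2 := by
  cases u <;> simp only [twistComponentCard, twistLabel] <;> ring

theorem twistLabel_pos {m n : ℕ} (hm : 0 < m) (hn : 0 < n) (u : TwistEdge) :
    0 < twistLabel m n u := by
  cases u <;> simp only [twistLabel] <;> omega

theorem twistComponentCard_pos {k m n : ℕ} (hk : 0 < k) (hm : 0 < m) (hn : 0 < n)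
    (u : TwistEdge) : 0 < twistComponentCard k m n u := by
  cases u <;> simp only [twistComponentCard] <;> positivity

theorem theorem5p1 (k m n : ℕ) (hk : 0 < k) (hm : 0 < m) (hn : 0 < n) (s : TwistEdge → Bool) :
    Nat.card (((twistDiagram k).reorient s).NQuandle (twistLabel m n)) =
      4 * k * m * n + 2 * k * m + 2 * k * n ∧
    (∀ x y : TwistArc k,
      quandleComponent (((twistDiagram k).reorient s).arcGen (twistLabel m n) x) =
        quandleComponent (((twistDiagram k).reorient s).arcGen (twistLabel m n) y) ↔
      x.edge = y.edge) ∧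
    (∀ q : ((twistDiagram k).reorient s).NQuandle (twistLabel m n), ∃ x : TwistArc k,
      q ∈ quandleComponent (((twistDiagram k).reorient s).arcGen (twistLabel m n) x)) ∧
    (∀ x : TwistArc k,
      Nat.card (quandleComponent (((twistDiagram k).reorient s).arcGen (twistLabel m n) x)) =
        twistComponentCard k m n x.edge) := by
  let gen := (twistDiagram k).reorientedGen s (twistLabel m n)
  have hM := isMeridianSystem_twist (n := n) hk hm
  have hcl := closure_range_twistArcMeridian (k := k) (m := m) (n := n)
  obtain ⟨ρ, hρ⟩ := (twistRelations_signedAct (m := m) (n := n) (s := s)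
    SpatialGraphDiagram.isColoring_reorientedGen).exists_hom
  have hfst {q} {x : TwistArc k} (hq : q ∈ quandleComponent (gen x)) :
      (hM.toCoset s q).1 = x.edge := hM.toCoset_fst_of_mem hcl ρ hρ hq
  have hmem (q) : ∃ x : TwistArc k, q ∈ quandleComponent (gen x) :=
    PresentedQuandle.exists_mem_component_gen q
  have hcard (x : TwistArc k) :
      Nat.card (quandleComponent (gen x)) = twistComponentCard k m n x.edge := by
    have h := hM.card_component hcl ρ hρ (x.edge.baseArc k) (twistTransport_baseArc k m n x.edge)
    have he : (twistDiagram k).edge (x.edge.baseArc k) = x.edge := TwistEdge.edge_baseArc k x.edge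
    rw [he, orderOf_twistMeridian hk hm, natCard_twistGroup hk hm hn,
      ← twistComponentCard_mul_twistLabel k m n x.edge] at h
    rw [component_eq_component_baseArc x]
    exact Nat.eq_of_mul_eq_mul_right (twistLabel_pos hm hn _) h
  refine ⟨?_, fun x y => ⟨fun hxy => ?_, fun hxy => ?_⟩, hmem, hcard⟩
  · let p (q : (twistDiagram k).ReorientedNQuandle s (twistLabel m n)) : TwistEdge :=
      (hM.toCoset s q).1
    -- Every `q` lies in the component of some arc, and the edge of that arc has to be `p q`.
    have hfib (u : TwistEdge) : {q | p q = u} = quandleComponent (gen (u.baseArc k)) := by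
      ext q
      constructor
      · intro hq
        obtain ⟨x, hx⟩ := hmem q
        have hxu : x.edge = u := (hfst hx).symm.trans hq
        rwa [component_eq_component_baseArc x, hxu] at hx
      · intro hq
        exact (hfst hq).trans (TwistEdge.edge_baseArc k u)
    have hfibcard (u : TwistEdge) : Nat.card {q // p q = u} = twistComponentCard k m n u := by
      have h := hcard (u.baseArc k)
      rwa [← hfib, TwistEdge.edge_baseArc] at h
    -- `Nat.card` is `0` on infinite types, so a positive value yields finiteness.
    have hfin (u : TwistEdge) : Finite {q // p q = u} :=
      Nat.finite_of_card_ne_zero ((hfibcard u).trans_ne (twistComponentCard_pos hk hm hn u).ne')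
    refine (Nat.card_congr (Equiv.sigmaFiberEquiv p)).symm.trans ?_
    rw [natCard_sigma_twistEdge hfin]
    simp only [hfibcard, twistComponentCard]
    ring
  · have hx : gen x ∈ quandleComponent (gen x) := MulAction.mem_orbit_self _
    have hy : gen x ∈ quandleComponent (gen y) := by
      rw [← (show quandleComponent (gen x) = quandleComponent (gen y) from hxy)]
      exact hx
    exact (hfst hx).symm.trans (hfst hy)
  · refine (component_eq_component_baseArc x).trans ?_
    rw [hxy]
    exact (component_eq_component_baseArc y).symm
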